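/- **Definition (Atiyah determinant).** Let $x_1,\dots,x_n$ be distinct points of $\mathbb R^3$, $x_i=(x_{i,1},x_{i,2},x_{i,3})$. For each pair $i<j$ choose complex numbers $z_{i,j},w_{i,j}$ with $|z_{i,j}|^2+|w_{i,j}|^2=1$ and $$\frac{z_{i,j}}{w_{i,j}}=\frac{(x_{j,1}-x_{i,1})+(x_{j,2}-x_{i,2})\sqrt{-1}}{\sqrt{\sum_{k=1}^3(x_{j,k}-x_{i,k})^2}-(x_{j,3}-x_{i,3})},$$ where $w_{i,j}=0$ if the denominator of the right-hand side vanishes. For $i>j$ put $z_{i,j}=-\overline{w_{j,i}}$ and $w_{i,j}=\overline{z_{j,i}}$. Let $a_{i,j}$ be the coefficient of $t_1^{j-1}t_2^{n-j}$ in the polynomial $f_i(t_1,t_2)=\prod_{k\ne i}(z_{i,k}t_1-w_{i,k}t_2)$. The Atiyah determinant is $D(x_1,\dots,x_n)=\det(a_{i,j})_{1\le i,j\le n}$; it does not depend on the choices made. **Theorem.** Let $x_1,x_2,x_3,x_4\in\mathbb R^3$ be the vertices of a quadrilateral inscribed in a circle, that is, four distinct points lying on a common circle. Then $$|D(x_1,x_2,x_3,x_4)|^2\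 \ge\ |D(x_2,x_3,x_4)|\cdot|D(x_1,x_3,x_4)|\cdot|D(x_1,x_2,x_4)|\cdot|D(x_1,x_2,x_3)|.$$ -/

import Mathlib

open scoped ComplexConjugate

noncomputable section

namespace AtiyahSutcliffe

/-- Three-dimensional Euclidean space. -/
abbrev Space := EuclideanSpace ℝ (Fin 3)

/-- The numerator `v₁ + v₂ √-1` of the stereographic coordinate of the direction of `v`. -/
def dirNum (v : Space) : ℂ := (v 0 : ℂ) + (v 1 : ℂ) * Complex.I

/-- The denominator `√(v₁² + v₂² + v₃²) - v₃` of the stereographic coordinate of the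
direction of `v`. -/
def dirDen (v : Space) : ℝ := Real.sqrt (∑ k, v k ^ 2) - v 2

/-- `z` and `w` are admissible choices of the complex numbers `z i j`, `w i j` in the construction
of the Atiyah determinant of the points `x 0, …, x (n - 1)`. The diagonal values are never used. -/
structure IsAdmissible {n : ℕ} (x : Fin n → Space) (z w : Fin n → Fin n → ℂ) : Prop where
  norm_sq : ∀ i j, i < j → ‖z i j‖ ^ 2 + ‖w i j‖ ^ 2 = 1
  ratio : ∀ i j, i < j → dirDen (x j - x i) ≠ 0 →
    w i j ≠ 0 ∧ z i j / w i j = dirNum (x j - x i) / (dirDen (x j - x i) : ℂ)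
  w_eq_zero : ∀ i j, i < j → dirDen (x j - x i) = 0 → w i j = 0
  z_symm : ∀ i j, j < i → z i j = -conj (w j i)
  w_symm : ∀ i j, j < i → w i j = conj (z j i)

/-- The polynomial `f_i(t₁, t₂) = ∏_{k ≠ i} (z_{i,k} t₁ - w_{i,k} t₂)`; the variables `t₁`, `t₂`
are `X 0`, `X 1`. -/
def rowPoly {n : ℕ} (z w : Fin n → Fin n → ℂ) (i : Fin n) : MvPolynomial (Fin 2) ℂ :=
  ∏ k ∈ Finset.univ.erase i,
    (MvPolynomial.C (z i k) * MvPolynomial.X 0 - MvPolynomial.C (w i k) * MvPolynomial.X 1)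

/-- The matrix of coefficients of the polynomials `f_i`. With rows and columns numbered from `0`,
column `j` holds the coefficients at `t₁ ^ j * t₂ ^ (n - 1 - j)`. -/
def coeffMatrix {n : ℕ} (z w : Fin n → Fin n → ℂ) : Matrix (Fin n) (Fin n) ℂ :=
  Matrix.of fun i j =>
    (rowPoly z w i).coeff (Finsupp.single 0 (j : ℕ) + Finsupp.single 1 (n - 1 - (j : ℕ)))

/-- A unit vector of `ℂ²` whose ratio of coordinates is `dirNum v / dirDen v`: first coordinate. -/
def liftZ (v : Space) : ℂ :=
  if dirDen v = 0 then 1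
  else dirNum v / (Real.sqrt (‖dirNum v‖ ^ 2 + dirDen v ^ 2) : ℂ)

/-- A unit vector of `ℂ²` whose ratio of coordinates is `dirNum v / dirDen v`: second coordinate. -/
def liftW (v : Space) : ℂ :=
  if dirDen v = 0 then 0
  else (dirDen v : ℂ) / (Real.sqrt (‖dirNum v‖ ^ 2 + dirDen v ^ 2) : ℂ)

/-- A particular admissible choice of the numbers `z i j`. -/
def stdZ {n : ℕ} (x : Fin n → Space) (i j : Fin n) : ℂ :=
  if i < j then liftZ (x j - x i) else -conj (liftW (x i - x j))

/-- A particular admissible choice of the numbers `w i j`. -/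
def stdW {n : ℕ} (x : Fin n → Space) (i j : Fin n) : ℂ :=
  if i < j then liftW (x j - x i) else conj (liftZ (x i - x j))

/-- The Atiyah determinant `D(x_1, …, x_n)`. It is computed from one particular admissible choice;
`atiyahDet_eq` says that every admissible choice gives the same value. -/
def atiyahDet {n : ℕ} (x : Fin n → Space) : ℂ :=
  (coeffMatrix (stdZ x) (stdW x)).det

theorem isAdmissible_std {n : ℕ} (x : Fin n → Space) : IsAdmissible x (stdZ x) (stdW x) := by
  have key : ∀ v : Space, dirDen v ≠ 0 → 0 < Real.sqrt (‖dirNum v‖ ^ 2 + dirDen v ^ 2) := by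
    intro v hv
    apply Real.sqrt_pos.2
    positivity
  refine ⟨?_, ?_, ?_, ?_, ?_⟩
  · intro i j h
    simp only [stdZ, stdW, h, if_true]
    by_cases hd : dirDen (x j - x i) = 0
    · simp [liftZ, liftW, hd]
    · have hk := key _ hd
      simp only [liftZ, liftW, hd, if_false, norm_div, Complex.norm_real, Real.norm_eq_abs,
        div_pow, sq_abs]
      rw [Real.sq_sqrt (by positivity), ← add_div, div_self]
      positivity
  · intro i j h hd
    have hk : (Real.sqrt (‖dirNum (x j - x i)‖ ^ 2 + dirDen (x j - x i) ^ 2) : ℂ) ≠ 0 := by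
      exact_mod_cast (key _ hd).ne'
    have hd' : (dirDen (x j - x i) : ℂ) ≠ 0 := by exact_mod_cast hd
    simp only [stdZ, stdW, h, if_true, liftZ, liftW, hd, if_false]
    exact ⟨div_ne_zero hd' hk, div_div_div_cancel_right₀ hk _ _⟩
  · intro i j h hd
    simp [stdW, h, liftW, hd]
  · intro i j h
    simp [stdZ, stdW, h, h.not_gt]
  · intro i j h
    simp [stdZ, stdW, h, h.not_gt]

/-- Two admissible choices differ by unit complex factors. -/
theorem IsAdmissible.exists_phase {n : ℕ} {x : Fin n → Space} {z w z' w' : Fin n → Fin n → ℂ}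
    (h : IsAdmissible x z w) (h' : IsAdmissible x z' w') (i j : Fin n) (hij : i < j) :
    ∃ c : ℂ, c * conj c = 1 ∧ z' i j = c * z i j ∧ w' i j = c * w i j := by
  have h1 := h.norm_sq i j hij
  have h1' := h'.norm_sq i j hij
  have unit : ∀ c : ℂ, ‖c‖ ^ 2 = 1 → c * conj c = 1 := by
    intro c hc
    rw [Complex.mul_conj, Complex.normSq_eq_norm_sq, hc, Complex.ofReal_one]
  by_cases hd : dirDen (x j - x i) = 0
  · have hw := h.w_eq_zero i j hij hd
    have hw' := h'.w_eq_zero i j hij hd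
    rw [hw] at h1
    rw [hw'] at h1'
    simp only [norm_zero, ne_eq, OfNat.ofNat_ne_zero, not_false_eq_true, zero_pow, add_zero]
      at h1 h1'
    have hz : z i j ≠ 0 := by
      rintro h0
      simp [h0] at h1
    refine ⟨z' i j / z i j, unit _ ?_, (div_mul_cancel₀ _ hz).symm, by simp [hw, hw']⟩
    rw [norm_div, div_pow, h1, h1', div_one]
  · obtain ⟨hw, hr⟩ := h.ratio i j hij hd
    obtain ⟨hw', hr'⟩ := h'.ratio i j hij hd
    have hz : z i j = dirNum (x j - x i) / (dirDen (x j - x i) : ℂ) * w i j := by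
      rw [← hr, div_mul_cancel₀ _ hw]
    have hz' : z' i j = dirNum (x j - x i) / (dirDen (x j - x i) : ℂ) * w' i j := by
      rw [← hr', div_mul_cancel₀ _ hw']
    generalize dirNum (x j - x i) / (dirDen (x j - x i) : ℂ) = q at hz hz'
    refine ⟨w' i j / w i j, unit _ ?_, ?_, (div_mul_cancel₀ _ hw).symm⟩
    · rw [hz, norm_mul] at h1
      rw [hz', norm_mul] at h1'
      have hn : ‖w i j‖ ≠ 0 := norm_ne_zero_iff.2 hw
      have hq : ‖q‖ ^ 2 + 1 ≠ 0 := by positivity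
      rw [norm_div, div_pow, div_eq_one_iff_eq (pow_ne_zero 2 hn)]
      apply mul_left_cancel₀ hq
      linear_combination h1' - h1
    · rw [hz, hz']
      field_simp

theorem IsAdmissible.det_eq {n : ℕ} {x : Fin n → Space} {z w z' w' : Fin n → Fin n → ℂ}
    (h : IsAdmissible x z w) (h' : IsAdmissible x z' w') :
    (coeffMatrix z' w').det = (coeffMatrix z w).det := by
  choose c hc hz hw using h.exists_phase h'
  let d : Fin n → Fin n → ℂ := fun i k =>
    if hik : i < k then c i k hik else if hki : k < i then conj (c k i hki) else 1
  have hdz : ∀ i k, k ≠ i → z' i k = d i k * z i k ∧ w' i k = d i k * w i k := by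
    intro i k hk
    rcases lt_or_gt_of_ne hk with hlt | hlt
    · simp only [d, hlt.not_gt, hlt, dif_pos, dif_neg, not_false_eq_true]
      rw [h.z_symm i k hlt, h.w_symm i k hlt, h'.z_symm i k hlt, h'.w_symm i k hlt, hz k i hlt,
        hw k i hlt]
      simp
    · simp only [d, hlt, dif_pos]
      exact ⟨hz i k hlt, hw i k hlt⟩
  have hrow : ∀ i, rowPoly z' w' i = MvPolynomial.C (∏ k ∈ Finset.univ.erase i, d i k) *
      rowPoly z w i := by
    intro i
    rw [rowPoly, rowPoly, map_prod, ← Finset.prod_mul_distrib]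
    refine Finset.prod_congr rfl fun k hk => ?_
    obtain ⟨e1, e2⟩ := hdz i k (Finset.ne_of_mem_erase hk)
    rw [e1, e2, map_mul, map_mul]
    ring
  have hmat : coeffMatrix z' w' = Matrix.of fun i j =>
      (∏ k ∈ Finset.univ.erase i, d i k) * coeffMatrix z w i j := by
    ext i j
    simp only [coeffMatrix, Matrix.of_apply, hrow, MvPolynomial.coeff_C_mul]
  have hprod : ∏ i, ∏ k ∈ Finset.univ.erase i, d i k = 1 := by
    have e : ∀ i, ∏ k ∈ Finset.univ.erase i, d i k =
        (∏ k, if i < k then d i k else 1) * ∏ k, if k < i then d i k else 1 := by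
      intro i
      rw [← Finset.prod_mul_distrib, ← Finset.mul_prod_erase Finset.univ _ (Finset.mem_univ i)]
      simp only [lt_irrefl, if_false, one_mul]
      refine Finset.prod_congr rfl fun k hk => ?_
      rcases lt_or_gt_of_ne (Finset.ne_of_mem_erase hk) with hlt | hlt
      · simp [hlt, hlt.not_gt]
      · simp [hlt, hlt.not_gt]
    simp only [e]
    rw [Finset.prod_mul_distrib]
    rw [Finset.prod_comm (f := fun i k => if k < i then d i k else 1), ← Finset.prod_mul_distrib]
    refine Finset.prod_eq_one fun i _ => ?_
    rw [← Finset.prod_mul_distrib]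
    refine Finset.prod_eq_one fun k _ => ?_
    by_cases hik : i < k
    · simp only [hik, if_true, d, dif_pos, hik.not_gt, dif_neg, not_false_eq_true]
      exact hc i k hik
    · simp [hik]
  rw [hmat, Matrix.det_mul_column, hprod, one_mul]

/-- The Atiyah determinant does not depend on the choices made in its construction. -/
theorem atiyahDet_eq {n : ℕ} {x : Fin n → Space} {z w : Fin n → Fin n → ℂ}
    (h : IsAdmissible x z w) : (coeffMatrix z w).det = atiyahDet x :=
  (isAdmissible_std x).det_eq h

end AtiyahSutcliffe

end

open scoped ComplexConjugate

noncomputable section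

namespace AtiyahSutcliffe

/-! A pair `(z, w)` is a unit spinor of the direction from one point to another. Changing spinors by
phases multiplies rows of the coefficient matrix by unit scalars, so the modulus of the determinant
depends only on the directions, and not on the labelling of the points. A linear substitution of the
spinors multiplies the determinant by a power of the determinant of that substitution
(`det_coeffMatrix_linear`); this moves the plane of the circle to a standard position.

With the points written as `R * exp (2iθ_k)`, the chord from the `i`-th to the `k`-th has direction
`±i * exp (i(θ_i + θ_k))`. Up to unit factors and powers of `2`, the determinants become explicit
cosine sums. Let `2A, 2B, 2C, 2D` be the inscribed angles over the four sides, so `A + B + C + D = π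
/ 2`. A triangle has modulus `1 + p`, where `p` is the product of the sines of its half angles, for
instance `p = sin A * sin B * cos (A + B)`. The quadrilateral has modulus `1 + m + y`, where `m` is
the sum of these products over two opposite triangles (`quadCos_eq_half_angles`).

Both pairs of opposite triangles give the same `m` (`opposite_triangles_sum`), so by AM-GM the
product over the four triangles is at most `(1 + m/2)^4`. The estimate `y ≥ p^2 + q^2 ≥ m^2/4`, from
`sq_le_sin_mul_cos`, gives `(1 + m/2)^2 ≤ 1 + m + y`. -/

/-! ### Spinors of directions, and independence of their phases. -/

/-- `(z, w)` is a unit vector of `ℂ²` which the Hopf map sends to the direction of `v`. -/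
structure IsSpinor (v : Space) (z w : ℂ) : Prop where
  unit : z * conj z + w * conj w = 1
  num : 2 * (z * conj w) * (‖v‖ : ℂ) = dirNum v
  height : (z * conj z - w * conj w) * (‖v‖ : ℂ) = (v 2 : ℂ)

/-- A choice of unit spinors of all the directions `x k - x i`. -/
def IsSpinorField {n : ℕ} (x : Fin n → Space) (z w : Fin n → Fin n → ℂ) : Prop :=
  ∀ i k, i ≠ k → IsSpinor (x k - x i) (z i k) (w i k)

theorem norm_eq_sqrt_sum (v : Space) : Real.sqrt (∑ k, v k ^ 2) = ‖v‖ := by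
  rw [EuclideanSpace.norm_eq]; simp

theorem dirDen_eq (v : Space) : dirDen v = ‖v‖ - v 2 := by
  rw [dirDen, norm_eq_sqrt_sum]

theorem dirNum_mul_conj (v : Space) :
    dirNum v * conj (dirNum v) + (v 2 : ℂ) ^ 2 = (‖v‖ : ℂ) ^ 2 := by
  have h : ‖v‖ ^ 2 = v 0 ^ 2 + v 1 ^ 2 + v 2 ^ 2 := by
    rw [EuclideanSpace.norm_sq_eq]; simp [Fin.sum_univ_three]
  rw [← Complex.ofReal_pow ‖v‖, h]
  simp only [dirNum, map_add, map_mul, Complex.conj_ofReal, Complex.conj_I]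
  push_cast
  linear_combination (-(v 1 : ℂ) ^ 2) * Complex.I_sq

theorem dirNum_sub (u v : Space) : dirNum (u - v) = dirNum u - dirNum v := by
  simp [dirNum]; ring

theorem dirNum_neg (v : Space) : dirNum (-v) = -dirNum v := by
  simp [dirNum]; ring

theorem isSpinor_of_dirDen_eq_zero {v : Space} {z w : ℂ} (hu : ‖z‖ ^ 2 + ‖w‖ ^ 2 = 1)
    (hd : dirDen v = 0) (hw : w = 0) : IsSpinor v z w := by
  have hv : (v 2 : ℂ) = (‖v‖ : ℂ) := by
    rw [dirDen_eq] at hd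
    exact_mod_cast (sub_eq_zero.1 hd).symm
  have hn : dirNum v = 0 := by
    have h := dirNum_mul_conj v
    rw [hv] at h
    have h0 : dirNum v * conj (dirNum v) = 0 := by linear_combination h
    simpa using h0
  have hz : z * conj z = 1 := by
    rw [hw] at hu
    rw [norm_zero, zero_pow two_ne_zero, add_zero] at hu
    rw [Complex.mul_conj, Complex.normSq_eq_norm_sq, hu, Complex.ofReal_one]
  refine ⟨by rw [hz, hw]; simp, by rw [hn, hw]; simp, by rw [hz, hw, hv]; simp⟩

theorem isSpinor_of_ratio {v : Space} {z w : ℂ} (hu : ‖z‖ ^ 2 + ‖w‖ ^ 2 = 1)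
    (hd : dirDen v ≠ 0) (hw : w ≠ 0) (hr : z / w = dirNum v / (dirDen v : ℂ)) :
    IsSpinor v z w := by
  have hu' : z * conj z + w * conj w = 1 := by
    rw [Complex.mul_conj, Complex.mul_conj, Complex.normSq_eq_norm_sq, Complex.normSq_eq_norm_sq]
    exact_mod_cast hu
  have hd' : (dirDen v : ℂ) ≠ 0 := by exact_mod_cast hd
  have e1 : z * (dirDen v : ℂ) = w * dirNum v := by
    field_simp at hr
    linear_combination hr
  have e2 : conj z * (dirDen v : ℂ) = conj w * conj (dirNum v) := by
    have := congrArg conj e1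
    simpa using this
  have hden : (dirDen v : ℂ) = ‖v‖ - v 2 := by rw [dirDen_eq]; push_cast; rfl
  have hN := dirNum_mul_conj v
  -- the squared modulus of `w`
  have e3 : w * conj w * (2 * (‖v‖ : ℂ)) = dirDen v := by
    apply mul_right_cancel₀ hd'
    have : z * conj z * (dirDen v : ℂ) ^ 2 = w * conj w * (dirNum v * conj (dirNum v)) := by
      linear_combination (conj z * (dirDen v : ℂ)) * e1 + (w * dirNum v) * e2
    rw [hden] at this ⊢
    linear_combination ((‖v‖ : ℂ) - v 2) ^ 2 * hu' - this - (w * conj w) * hN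
  refine ⟨hu', ?_, ?_⟩
  · apply mul_right_cancel₀ hd'
    linear_combination (2 * conj w * (‖v‖ : ℂ)) * e1 + dirNum v * e3
  · rw [hden] at e3
    linear_combination (‖v‖ : ℂ) * hu' - e3

theorem isSpinor_lift (v : Space) : IsSpinor v (liftZ v) (liftW v) := by
  -- The standard lift is already known to be admissible; the two points `0, v` isolate a single
  -- direction.
  have h := isAdmissible_std ![(0 : Space), v]
  have e1 : stdZ ![(0 : Space), v] 0 1 = liftZ v := by simp [stdZ]
  have e2 : stdW ![(0 : Space), v] 0 1 = liftW v := by simp [stdW]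
  have hn := h.norm_sq 0 1 (by decide)
  have hr := h.ratio 0 1 (by decide)
  have hw := h.w_eq_zero 0 1 (by decide)
  rw [e1, e2] at hn hr
  rw [e2] at hw
  simp only [Matrix.cons_val_zero, Matrix.cons_val_one, sub_zero] at hr hw
  by_cases hd : dirDen v = 0
  · exact isSpinor_of_dirDen_eq_zero hn hd (hw hd)
  · exact isSpinor_of_ratio hn hd (hr hd).1 (hr hd).2

theorem IsSpinor.antipodal {v : Space} {z w : ℂ} (h : IsSpinor v z w) :
    IsSpinor (-v) (-conj w) (conj z) := by
  obtain ⟨h1, h2, h3⟩ := h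
  refine ⟨?_, ?_, ?_⟩
  · simp only [map_neg, Complex.conj_conj]; linear_combination h1
  · rw [norm_neg, dirNum_neg]; simp only [Complex.conj_conj]; linear_combination -h2
  · rw [norm_neg, PiLp.neg_apply]; simp only [map_neg, Complex.conj_conj]; push_cast
    linear_combination -h3

theorem isSpinorField_std {n : ℕ} (x : Fin n → Space) : IsSpinorField x (stdZ x) (stdW x) := by
  intro i k hik
  rcases lt_or_gt_of_ne hik with h | h
  · simp only [stdZ, stdW, h, if_true]
    exact isSpinor_lift _
  · simp only [stdZ, stdW, h.not_gt, if_false]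
    rw [← neg_sub]
    exact (isSpinor_lift _).antipodal

/-- The spinor of a direction is determined up to a phase. -/
theorem IsSpinor.exists_phase {v : Space} (hv : v ≠ 0) {z w z' w' : ℂ} (h : IsSpinor v z w)
    (h' : IsSpinor v z' w') : ∃ c : ℂ, ‖c‖ = 1 ∧ z' = c * z ∧ w' = c * w := by
  have hn : (‖v‖ : ℂ) ≠ 0 := by simpa using hv
  have e1 : z' * conj w' = z * conj w :=
    mul_right_cancel₀ hn (by linear_combination (h'.num - h.num) / 2)
  have e2 : z' * conj z' - w' * conj w' = z * conj z - w * conj w :=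
    mul_right_cancel₀ hn (by linear_combination h'.height - h.height)
  have e3 : z' * conj z' = z * conj z := by linear_combination (e2 + h'.unit - h.unit) / 2
  have e4 : w' * conj w' = w * conj w := by linear_combination (-e2 + h'.unit - h.unit) / 2
  have e5 : conj z' * w' = conj z * w := by simpa using congrArg conj e1
  have aux : ∀ a b : ℂ, a ≠ 0 → b * conj b = a * conj a → ‖b / a‖ = 1 := by
    intro a b ha hab
    rw [Complex.mul_conj, Complex.mul_conj, Complex.normSq_eq_norm_sq,
      Complex.normSq_eq_norm_sq] at hab
    have : ‖b‖ ^ 2 = ‖a‖ ^ 2 := by exact_mod_cast hab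
    rw [norm_div, (sq_eq_sq₀ (norm_nonneg _) (norm_nonneg _)).1 this,
      div_self (norm_ne_zero_iff.2 ha)]
  by_cases hz : z = 0
  · have hw : w ≠ 0 := by
      rintro rfl
      simpa [hz] using h.unit
    have hz' : z' = 0 := by simpa [hz] using e3
    exact ⟨w' / w, aux _ _ hw e4, by simp [hz, hz'], (div_mul_cancel₀ _ hw).symm⟩
  · refine ⟨z' / z, aux _ _ hz e3, (div_mul_cancel₀ _ hz).symm, ?_⟩
    have hcz' : conj z' ≠ 0 := by
      intro h0
      rw [h0] at e3
      simp [hz] at e3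
    apply mul_left_cancel₀ hcz'
    have e6 : conj z' * (z' / z * w) = z' * conj z' * (w / z) := by ring
    rw [e5, e6, e3]
    field_simp

/-- The modulus of the Atiyah determinant can be computed from any choice of spinors. -/
theorem IsSpinorField.norm_det {n : ℕ} {x : Fin n → Space} (hx : Function.Injective x)
    {z w : Fin n → Fin n → ℂ} (h : IsSpinorField x z w) :
    ‖(coeffMatrix z w).det‖ = ‖atiyahDet x‖ := by
  have hc : ∀ i k, ∃ c : ℂ, ‖c‖ = 1 ∧ (i ≠ k → z i k = c * stdZ x i k ∧ w i k = c * stdW x i k) := by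
    intro i k
    by_cases hik : i = k
    · exact ⟨1, by simp, fun h => absurd hik h⟩
    · obtain ⟨c, hc, hc'⟩ := (isSpinorField_std x i k hik).exists_phase
        (sub_ne_zero.2 fun e => hik (hx e).symm) (h i k hik)
      exact ⟨c, hc, fun _ => hc'⟩
  choose c hc1 hc2 using hc
  have hmat : coeffMatrix z w = Matrix.of fun i j =>
      (∏ k ∈ Finset.univ.erase i, c i k) * coeffMatrix (stdZ x) (stdW x) i j := by
    ext i j
    have hrow : rowPoly z w i = MvPolynomial.C (∏ k ∈ Finset.univ.erase i, c i k) *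
        rowPoly (stdZ x) (stdW x) i := by
      rw [rowPoly, rowPoly, map_prod, ← Finset.prod_mul_distrib]
      refine Finset.prod_congr rfl fun k hk => ?_
      obtain ⟨e1, e2⟩ := hc2 i k (Finset.ne_of_mem_erase hk).symm
      rw [e1, e2, map_mul, map_mul]
      ring
    simp only [coeffMatrix, Matrix.of_apply, hrow, MvPolynomial.coeff_C_mul]
  rw [hmat, Matrix.det_mul_column, norm_mul, norm_prod]
  simp [norm_prod, hc1, atiyahDet]

/-! ### Relabelling the points. -/

/-- The modulus of the Atiyah determinant does not depend on the order of the points. -/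
theorem norm_atiyahDet_comp_perm {n : ℕ} {x : Fin n → Space} (hx : Function.Injective x)
    (σ : Equiv.Perm (Fin n)) : ‖atiyahDet (x ∘ σ)‖ = ‖atiyahDet x‖ := by
  have h : IsSpinorField (x ∘ σ) (fun i k => stdZ x (σ i) (σ k)) fun i k => stdW x (σ i) (σ k) :=
    fun i k hik => isSpinorField_std x (σ i) (σ k) (σ.injective.ne hik)
  rw [← h.norm_det (hx.comp σ.injective), atiyahDet]
  have hmat : coeffMatrix (fun i k => stdZ x (σ i) (σ k)) (fun i k => stdW x (σ i) (σ k)) =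
      (coeffMatrix (stdZ x) (stdW x)).submatrix σ id := by
    ext i j
    simp only [coeffMatrix, Matrix.of_apply, Matrix.submatrix_apply, id]
    congr 1
    rw [rowPoly, rowPoly]
    refine Finset.prod_bij (fun k _ => σ k) ?_ ?_ ?_ ?_
    · intro k hk
      simpa using hk
    · intro a _ b _ hab
      exact σ.injective hab
    · intro b hb
      refine ⟨σ.symm b, ?_, by simp⟩
      rw [Finset.mem_erase] at hb ⊢
      refine ⟨?_, Finset.mem_univ _⟩
      rintro rfl
      simp at hb
    · intro k _
      rfl
  rw [hmat, Matrix.det_permute, norm_mul]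
  rcases Int.units_eq_one_or (Equiv.Perm.sign σ) with e | e <;> simp [e]

/-- Omitting a point after a permutation is the same as permuting what remains. -/
theorem exists_perm_comp_succAbove {n : ℕ} (σ : Equiv.Perm (Fin (n + 1))) (i : Fin (n + 1)) :
    ∃ τ : Equiv.Perm (Fin n), ∀ k, σ (i.succAbove k) = (σ i).succAbove (τ k) := by
  refine ⟨(finSuccAboveEquiv i).trans ((σ.subtypeEquiv fun a => by simp).trans
    (finSuccAboveEquiv (σ i)).symm), fun k => ?_⟩
  have h := (finSuccAboveEquiv (σ i)).apply_symm_apply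
    ⟨σ (i.succAbove k), σ.injective.ne (Fin.succAbove_ne i k)⟩
  exact (congrArg Subtype.val h).symm

theorem prod_norm_atiyahDet_comp_perm {n : ℕ} {x : Fin (n + 1) → Space}
    (hx : Function.Injective x) (σ : Equiv.Perm (Fin (n + 1))) :
    ∏ i : Fin (n + 1), ‖atiyahDet ((x ∘ σ) ∘ i.succAbove)‖ =
      ∏ i : Fin (n + 1), ‖atiyahDet (x ∘ i.succAbove)‖ := by
  rw [← Equiv.prod_comp σ fun i => ‖atiyahDet (x ∘ i.succAbove)‖]
  refine Finset.prod_congr rfl fun i _ => ?_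
  obtain ⟨τ, hτ⟩ := exists_perm_comp_succAbove σ i
  rw [← norm_atiyahDet_comp_perm (hx.comp (Fin.succAbove_right_injective (p := σ i))) τ]
  congr 2
  ext1 k
  simp [hτ]

/-! ### Binary forms and linear covariance. -/

theorem single_add_single_inj {n : ℕ} {i j : Fin n}
    (h : (Finsupp.single 0 (i : ℕ) + Finsupp.single 1 (n - 1 - (i : ℕ)) : Fin 2 →₀ ℕ) =
      Finsupp.single 0 (j : ℕ) + Finsupp.single 1 (n - 1 - (j : ℕ))) : i = j := by
  have := DFunLike.congr_fun h 0
  simpa [Fin.ext_iff] using this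

/-- The coefficients of a binary form. -/
theorem coeff_sum_binary {n : ℕ} (c : Fin n → ℂ) (j : Fin n) :
    (∑ i : Fin n, MvPolynomial.C (c i) * MvPolynomial.X (0 : Fin 2) ^ (i : ℕ) *
      MvPolynomial.X 1 ^ (n - 1 - (i : ℕ))).coeff
        (Finsupp.single 0 (j : ℕ) + Finsupp.single 1 (n - 1 - (j : ℕ))) = c j := by
  have h : ∀ i : Fin n, (MvPolynomial.C (c i) * MvPolynomial.X (0 : Fin 2) ^ (i : ℕ) *
      MvPolynomial.X 1 ^ (n - 1 - (i : ℕ))) = MvPolynomial.monomial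
        (Finsupp.single 0 (i : ℕ) + Finsupp.single 1 (n - 1 - (i : ℕ))) (c i) := by
    intro i
    rw [MvPolynomial.X_pow_eq_monomial, MvPolynomial.X_pow_eq_monomial, mul_assoc,
      MvPolynomial.monomial_mul, MvPolynomial.C_mul_monomial]
    simp
  rw [MvPolynomial.coeff_sum]
  simp only [h, MvPolynomial.coeff_monomial]
  rw [Finset.sum_eq_single j]
  · simp
  · intro b _ hb
    rw [if_neg]
    exact fun e => hb (single_add_single_inj e)
  · simp

theorem rowPoly_isHomogeneous {n : ℕ} (z w : Fin n → Fin n → ℂ) (i : Fin n) :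
    (rowPoly z w i).IsHomogeneous (n - 1) := by
  have h := MvPolynomial.IsHomogeneous.prod (Finset.univ.erase i)
    (fun k => MvPolynomial.C (z i k) * MvPolynomial.X (0 : Fin 2) -
      MvPolynomial.C (w i k) * MvPolynomial.X 1) (fun _ => 1) fun k _ => by
        have h1 := (MvPolynomial.isHomogeneous_C (Fin 2) (z i k)).mul
          (MvPolynomial.isHomogeneous_X ℂ (0 : Fin 2))
        have h2 := (MvPolynomial.isHomogeneous_C (Fin 2) (w i k)).mul
          (MvPolynomial.isHomogeneous_X ℂ (1 : Fin 2))
        simpa using h1.sub h2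
  simpa [rowPoly, Finset.card_erase_of_mem] using h

/-- By homogeneity of degree `n - 1`, the `n` coefficients kept in the matrix are all the
coefficients of the form. -/
theorem rowPoly_eq_sum {n : ℕ} (z w : Fin n → Fin n → ℂ) (i : Fin n) :
    rowPoly z w i = ∑ j : Fin n, MvPolynomial.C (coeffMatrix z w i j) *
      MvPolynomial.X (0 : Fin 2) ^ (j : ℕ) * MvPolynomial.X 1 ^ (n - 1 - (j : ℕ)) := by
  have hn : 0 < n := i.pos
  ext d
  by_cases hd : d.degree = n - 1
  · have hd' : d 0 + d 1 = n - 1 := by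
      rw [← hd, Finsupp.degree_eq_sum]
      simp
    have e : d = Finsupp.single 0 ((⟨d 0, by omega⟩ : Fin n) : ℕ) +
        Finsupp.single 1 (n - 1 - ((⟨d 0, by omega⟩ : Fin n) : ℕ)) := by
      ext k
      fin_cases k
      · simp
      · simp; omega
    rw [e, coeff_sum_binary]
    rfl
  · rw [(rowPoly_isHomogeneous z w i).coeff_eq_zero hd, eq_comm]
    refine MvPolynomial.IsHomogeneous.coeff_eq_zero (n := n - 1) ?_ hd
    refine MvPolynomial.IsHomogeneous.sum _ _ _ fun j _ => ?_
    have h := ((MvPolynomial.isHomogeneous_C (Fin 2) (coeffMatrix z w i j)).mul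
      (MvPolynomial.isHomogeneous_X_pow (R := ℂ) (0 : Fin 2) (j : ℕ))).mul
      (MvPolynomial.isHomogeneous_X_pow (R := ℂ) (1 : Fin 2) (n - 1 - (j : ℕ)))
    have e : 0 + (j : ℕ) + (n - 1 - (j : ℕ)) = n - 1 := by omega
    rwa [e] at h

/-- The values of the forms `f_i` at the points `(s l, t l)`. -/
def evalMatrix {n : ℕ} (z w : Fin n → Fin n → ℂ) (s t : Fin n → ℂ) : Matrix (Fin n) (Fin n) ℂ :=
  Matrix.of fun i l => ∏ k ∈ Finset.univ.erase i, (z i k * s l - w i k * t l)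

/-- Evaluation of a form is linear in its coefficients. Determinants of coefficients can thus be
compared through values, where a substitution in the spinors becomes a substitution in the
evaluation points. -/
theorem coeffMatrix_mul_projVandermonde {n : ℕ} (z w : Fin n → Fin n → ℂ) (s t : Fin n → ℂ) :
    coeffMatrix z w * (Matrix.projVandermonde s t).transpose = evalMatrix z w s t := by
  ext i l
  have h := congrArg (MvPolynomial.eval ![s l, t l]) (rowPoly_eq_sum z w i)
  rw [rowPoly, map_prod, map_sum] at h
  simp only [map_mul, map_sub, map_pow, MvPolynomial.eval_C, MvPolynomial.eval_X,
    Matrix.cons_val_zero, Matrix.cons_val_one] at h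
  rw [evalMatrix, Matrix.of_apply, h, Matrix.mul_apply]
  refine Finset.sum_congr rfl fun j _ => ?_
  rw [Matrix.transpose_apply, Matrix.projVandermonde_apply, mul_assoc, Fin.val_rev]
  congr 3
  omega

/-- Covariance of the determinant under linear substitutions. -/
theorem det_coeffMatrix_linear {n : ℕ} (z w : Fin n → Fin n → ℂ) (p q r m : ℂ) :
    (coeffMatrix (fun i k => p * z i k + q * w i k) fun i k => r * z i k + m * w i k).det =
      (coeffMatrix z w).det * (p * m - q * r) ^ (∑ i : Fin n, (Finset.Ioi i).card) := by
  -- The points `(l, 1)` are pairwise non-proportional, so their Vandermonde determinant is nonzero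
  -- and can be cancelled at the end, even when `p * m - q * r = 0`.
  set s : Fin n → ℂ := fun l => (l : ℂ) with hs
  set t : Fin n → ℂ := fun _ => 1 with ht
  have e1 := coeffMatrix_mul_projVandermonde (fun i k => p * z i k + q * w i k)
    (fun i k => r * z i k + m * w i k) s t
  have e2 := coeffMatrix_mul_projVandermonde z w (fun l => p * s l - r * t l)
    fun l => m * t l - q * s l
  have e3 : evalMatrix (fun i k => p * z i k + q * w i k) (fun i k => r * z i k + m * w i k) s t =
      evalMatrix z w (fun l => p * s l - r * t l) fun l => m * t l - q * s l := by
    ext i l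
    simp only [evalMatrix, Matrix.of_apply]
    refine Finset.prod_congr rfl fun k _ => ?_
    ring
  have hdet := congrArg Matrix.det (e1.trans (e3.trans e2.symm))
  rw [Matrix.det_mul, Matrix.det_mul, Matrix.det_transpose, Matrix.det_transpose,
    Matrix.det_projVandermonde, Matrix.det_projVandermonde] at hdet
  have hV : ∏ i : Fin n, ∏ j ∈ Finset.Ioi i, (s j * t i - s i * t j) ≠ 0 := by
    refine Finset.prod_ne_zero_iff.2 fun i _ => Finset.prod_ne_zero_iff.2 fun j hj => ?_
    simp only [hs, ht, mul_one, sub_ne_zero]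
    exact_mod_cast (Fin.val_injective.ne (Finset.mem_Ioi.1 hj).ne')
  have hW : ∏ i : Fin n, ∏ j ∈ Finset.Ioi i,
      ((p * s j - r * t j) * (m * t i - q * s i) - (p * s i - r * t i) * (m * t j - q * s j)) =
      (p * m - q * r) ^ (∑ i : Fin n, (Finset.Ioi i).card) *
        ∏ i : Fin n, ∏ j ∈ Finset.Ioi i, (s j * t i - s i * t j) := by
    rw [← Finset.prod_pow_eq_pow_sum, ← Finset.prod_mul_distrib]
    refine Finset.prod_congr rfl fun i _ => ?_
    rw [← Finset.prod_const, ← Finset.prod_mul_distrib]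
    refine Finset.prod_congr rfl fun j _ => ?_
    ring
  rw [hW] at hdet
  apply mul_right_cancel₀ hV
  linear_combination hdet

/-! ### Complex coordinates in the plane of the circle. -/

/-- A coplanar set in space has a unit normal vector. -/
theorem exists_unit_normal {s : Set Space} (hs : Coplanar ℝ s) :
    ∃ e : Space, ‖e‖ = 1 ∧ ∀ a ∈ s, ∀ b ∈ s, inner ℝ (b - a) e = 0 := by
  have hV : (vectorSpan ℝ s)ᗮ ≠ ⊥ := by
    intro h
    rw [Submodule.orthogonal_eq_bot_iff] at h
    have h2 : Module.finrank ℝ (vectorSpan ℝ s) ≤ 2 := Module.finrank_le_of_rank_le hs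
    rw [h, finrank_top, finrank_euclideanSpace_fin] at h2
    omega
  obtain ⟨u, hu, hu0⟩ := Submodule.exists_mem_ne_zero_of_ne_bot hV
  refine ⟨(‖u‖⁻¹ : ℝ) • u, norm_smul_inv_norm hu0, fun a ha b hb => ?_⟩
  have h := (Submodule.mem_orthogonal _ _).1 hu _ (vsub_mem_vectorSpan ℝ hb ha)
  rw [vsub_eq_sub] at h
  rw [inner_smul_right, h, mul_zero]

/-- `2 ⟪v, e⟫` in terms of the complex coordinates. -/
theorem two_mul_inner (v e : Space) : 2 * ((inner ℝ v e : ℝ) : ℂ) =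
    dirNum v * conj (dirNum e) + conj (dirNum v) * dirNum e + 2 * v 2 * e 2 := by
  simp only [PiLp.inner_apply, Fin.sum_univ_three, dirNum, map_add, map_mul, Complex.conj_ofReal,
    Complex.conj_I, RCLike.inner_apply, conj_trivial]
  push_cast
  linear_combination (2 * (v 1 : ℂ) * e 1) * Complex.I_sq

/-- The coordinate, in the plane orthogonal to the direction with spinor `(α, β)`, of the
orthogonal projection of `v`. -/
def planeCoord (α β : ℂ) (v : Space) : ℂ :=
  dirNum v * conj α ^ 2 - conj (dirNum v) * conj β ^ 2 - 2 * v 2 * (conj α * conj β)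

theorem planeCoord_sub (α β : ℂ) (u v : Space) :
    planeCoord α β (u - v) = planeCoord α β u - planeCoord α β v := by
  simp only [planeCoord, dirNum_sub, map_sub, PiLp.sub_apply]
  push_cast
  ring

theorem conj_planeCoord (α β : ℂ) (v : Space) : conj (planeCoord α β v) =
    conj (dirNum v) * α ^ 2 - dirNum v * β ^ 2 - 2 * v 2 * (α * β) := by
  simp only [planeCoord, map_sub, map_mul, map_pow, Complex.conj_conj, Complex.conj_ofReal,
    map_ofNat]

/-- The vector with complex coordinates `ζ` in the plane orthogonal to the direction with
spinor `(α, β)`. -/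
structure IsPlaneVector (α β ζ : ℂ) (v : Space) : Prop where
  num : dirNum v = α ^ 2 * ζ - conj β ^ 2 * conj ζ
  height : (v 2 : ℂ) = -(α * β * ζ + conj α * conj β * conj ζ)

theorem IsSpinor.inner_eq {α β : ℂ} {e : Space} (he : ‖e‖ = 1) (h : IsSpinor e α β)
    (v : Space) : ((inner ℝ v e : ℝ) : ℂ) =
    dirNum v * (conj α * β) + conj (dirNum v) * (α * conj β) +
      v 2 * (α * conj α - β * conj β) := by
  have h1 := h.num
  have h2 := h.height
  rw [he, Complex.ofReal_one, mul_one] at h1 h2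
  have h3 := two_mul_inner v e
  rw [← h1, ← h2] at h3
  simp only [map_mul, Complex.conj_conj, map_ofNat] at h3
  linear_combination h3 / 2

/-- `planeCoord` is the horizontal part of `v` after the rotation carrying `e` to the third axis.
When the normal component vanishes, rotating back recovers `v`. -/
theorem IsSpinor.isPlaneVector {α β : ℂ} {e : Space} (he : ‖e‖ = 1) (h : IsSpinor e α β)
    {v : Space} (hv : inner ℝ v e = 0) :
    IsPlaneVector α β (planeCoord α β v) v := by
  have h0 := h.inner_eq he v
  rw [hv, Complex.ofReal_zero] at h0
  have hs := h.unit
  constructor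
  · rw [conj_planeCoord, planeCoord]
    linear_combination (-dirNum v * (α * conj α + β * conj β + 1)) * hs - 2 * α * conj β * h0
  · rw [conj_planeCoord, planeCoord]
    linear_combination (-(v 2 : ℂ) * (α * conj α + β * conj β + 1)) * hs +
      (β * conj β - α * conj α) * h0

/-- Pythagoras, for vectors not necessarily in the plane: the given centre of the sphere may lie
outside it. -/
theorem IsSpinor.normSq_planeCoord {α β : ℂ} {e : Space} (he : ‖e‖ = 1) (h : IsSpinor e α β)
    (v : Space) :
    ‖planeCoord α β v‖ ^ 2 + (inner ℝ v e) ^ 2 = ‖v‖ ^ 2 := by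
  have h0 := h.inner_eq he v
  have h1 := dirNum_mul_conj v
  have hs := h.unit
  have : planeCoord α β v * conj (planeCoord α β v) + ((inner ℝ v e : ℝ) : ℂ) ^ 2 =
      (‖v‖ : ℂ) ^ 2 := by
    rw [h0, conj_planeCoord, planeCoord]
    linear_combination h1 + (dirNum v * conj (dirNum v) + (v 2 : ℂ) ^ 2) *
      (α * conj α + β * conj β + 1) * hs
  rw [Complex.mul_conj, Complex.normSq_eq_norm_sq] at this
  exact_mod_cast this

theorem IsPlaneVector.norm_eq {α β ζ : ℂ} {v : Space} (hs : α * conj α + β * conj β = 1)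
    (h : IsPlaneVector α β ζ v) : ‖v‖ = ‖ζ‖ := by
  have h1 := dirNum_mul_conj v
  have h2 : conj (dirNum v) = conj α ^ 2 * conj ζ - β ^ 2 * ζ := by
    rw [h.num]; simp
  rw [h2, h.num, h.height] at h1
  have h3 : ζ * conj ζ = (‖v‖ : ℂ) ^ 2 := by
    linear_combination h1 - ζ * conj ζ * (α * conj α + β * conj β + 1) * hs
  rw [Complex.mul_conj, Complex.normSq_eq_norm_sq] at h3
  have h4 : ‖ζ‖ ^ 2 = ‖v‖ ^ 2 := by exact_mod_cast h3
  exact ((sq_eq_sq₀ (norm_nonneg _) (norm_nonneg _)).1 h4).symm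

/-- Spinors of the directions in a plane. -/
theorem IsPlaneVector.isSpinor {α β ζ u c : ℂ} {v : Space} (hs : α * conj α + β * conj β = 1)
    (h : IsPlaneVector α β ζ v) (hu : u * conj u = 1) (hc : c * conj c = 1 / 2)
    (hζ : u * (‖ζ‖ : ℂ) = ζ) :
    IsSpinor v (c * (α * u - conj β)) (c * (β * u + conj α)) := by
  have hcu : conj u * (‖ζ‖ : ℂ) = conj ζ := by
    have := congrArg conj hζ
    simpa using this
  have huζ : u * conj ζ = (‖ζ‖ : ℂ) := by
    rw [← hcu]
    linear_combination (‖ζ‖ : ℂ) * hu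
  -- The candidate is the image of `c * (u, 1)` under the `SU(2)` matrix with columns `(α, β)` and
  -- `(-conj β, conj α)`, which sends the spinor `(1, 0)` of the third axis to that of the normal.
  refine ⟨?_, ?_, ?_⟩
  · simp only [map_mul, map_sub, map_add, Complex.conj_conj]
    linear_combination (u * conj u + 1) * (α * conj α + β * conj β) * hc +
      (1 / 2 : ℂ) * (α * conj α + β * conj β) * hu + hs
  · rw [h.norm_eq hs, h.num]
    simp only [map_mul, map_add, Complex.conj_conj]
    linear_combination 2 * (‖ζ‖ : ℂ) * (α * u - conj β) * (conj β * conj u + α) * hc +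
      (‖ζ‖ : ℂ) * α * conj β * hu + α ^ 2 * hζ - conj β ^ 2 * hcu
  · rw [h.norm_eq hs, h.height]
    simp only [map_mul, map_sub, map_add, Complex.conj_conj]
    linear_combination (‖ζ‖ : ℂ) * ((α * u - conj β) * (conj α * conj u - β) -
      (β * u + conj α) * (conj β * conj u + α)) * hc + (1 / 2 : ℂ) * (‖ζ‖ : ℂ) *
      (α * conj α - β * conj β) * hu - α * β * hζ - conj α * conj β * hcu

/-- Concyclic points in complex coordinates of their plane centred at the centre of the circle. -/
theorem exists_planeCoord_of_concyclic {n : ℕ} {x : Fin n → Space}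
    (h : EuclideanGeometry.Concyclic (Set.range x)) :
    ∃ (α β : ℂ) (R : ℝ) (ζ : Fin n → ℂ), α * conj α + β * conj β = 1 ∧ (∀ i, ‖ζ i‖ = R) ∧
      ∀ i j, IsPlaneVector α β (ζ j - ζ i) (x j - x i) := by
  obtain ⟨⟨o, r, hr⟩, hcop⟩ := h
  obtain ⟨e, he, hperp⟩ := exists_unit_normal hcop
  have hsp := isSpinor_lift e
  generalize liftZ e = α, liftW e = β at hsp
  rcases isEmpty_or_nonempty (Fin n) with hn | ⟨⟨i₀⟩⟩
  · exact ⟨α, β, 0, 0, hsp.unit, fun i => hn.elim i, fun i => hn.elim i⟩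
  refine ⟨α, β, ‖planeCoord α β (x i₀ - o)‖, fun i => planeCoord α β (x i - o), hsp.unit,
    fun i => ?_, fun i j => ?_⟩
  · have h1 := hsp.normSq_planeCoord he (x i - o)
    have h2 := hsp.normSq_planeCoord he (x i₀ - o)
    have d1 : ‖x i - o‖ = r := by rw [← dist_eq_norm]; exact hr _ ⟨i, rfl⟩
    have d2 : ‖x i₀ - o‖ = r := by rw [← dist_eq_norm]; exact hr _ ⟨i₀, rfl⟩
    -- All points have the same height relative to `o`, so equal distances to `o` give equal
    -- distances to its projection, the centre of the circle.
    have hin : (inner ℝ (x i - o) e : ℝ) = inner ℝ (x i₀ - o) e := by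
      have := hperp _ ⟨i₀, rfl⟩ _ ⟨i, rfl⟩
      rw [← sub_eq_zero, ← inner_sub_left, sub_sub_sub_cancel_right]
      exact this
    rw [hin, d1] at h1
    rw [d2] at h2
    exact (sq_eq_sq₀ (norm_nonneg _) (norm_nonneg _)).1 (by linarith)
  · rw [← planeCoord_sub, sub_sub_sub_cancel_right]
    exact hsp.isPlaneVector he (hperp _ ⟨i, rfl⟩ _ ⟨j, rfl⟩)

/-! ### Reduction to points of the unit circle. -/

/-- The unit complex number of argument `t`. -/
def phase (t : ℝ) : ℂ := Complex.exp (t * Complex.I)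

theorem phase_mul_conj (t : ℝ) : phase t * conj (phase t) = 1 := by
  rw [Complex.mul_conj, Complex.normSq_eq_norm_sq, phase, Complex.norm_exp_ofReal_mul_I]
  simp

theorem phase_ne_zero (t : ℝ) : phase t ≠ 0 := Complex.exp_ne_zero _

theorem norm_phase (t : ℝ) : ‖phase t‖ = 1 := Complex.norm_exp_ofReal_mul_I t

theorem phase_sq_sub_sq (s t : ℝ) :
    phase t ^ 2 - phase s ^ 2 = phase s * phase t * (2 * Complex.I * Real.sin (t - s)) := by
  have h : (Real.sin (t - s) : ℂ) * (2 * Complex.I) =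
      Complex.exp ((t - s : ℝ) * Complex.I) - Complex.exp (-(t - s : ℝ) * Complex.I) := by
    rw [Complex.ofReal_sin, Complex.sin]
    linear_combination (Complex.exp (-((t - s : ℝ) : ℂ) * Complex.I) -
      Complex.exp (((t - s : ℝ) : ℂ) * Complex.I)) * Complex.I_sq
  have e : phase s * phase t * (2 * Complex.I * Real.sin (t - s)) =
      phase s * phase t * ((Real.sin (t - s) : ℂ) * (2 * Complex.I)) := by ring
  rw [e, h]
  simp only [phase, mul_sub, ← Complex.exp_add, ← Complex.exp_nat_mul]
  push_cast
  congr 2 <;> ring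

/-- The determinant attached to points `exp (2 i θ k)` of the unit circle. -/
def circleDet {n : ℕ} (θ : Fin n → ℝ) : ℂ :=
  (coeffMatrix (fun i k => (if i < k then 1 else -1) * (phase (θ i) * phase (θ k)))
    fun _ _ => 1).det

/-- Since `exp (2it) - exp (2is) = 2i * sin (t - s) * exp (i(s + t))`, the bounds on the gaps fix
the sign of each chord by the order of the indices. The spinors are then one fixed linear image of
the pairs `(± phase (θ i) * phase (θ k), 1)`, and covariance applies. -/
theorem norm_atiyahDet_eq_circleDet {n : ℕ} {x : Fin n → Space} (hx : Function.Injective x)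
    {α β : ℂ} (hs : α * conj α + β * conj β = 1) {R : ℝ} (hR : 0 ≤ R) {θ : Fin n → ℝ}
    (hθ : ∀ i k, i < k → 0 < θ k - θ i ∧ θ k - θ i < Real.pi)
    (h : ∀ i k, IsPlaneVector α β (R * phase (θ k) ^ 2 - R * phase (θ i) ^ 2) (x k - x i)) :
    ‖atiyahDet x‖ = (1 / 2) ^ (∑ i : Fin n, (Finset.Ioi i).card) * ‖circleDet θ‖ := by
  set c : ℂ := (Real.sqrt (1 / 2) : ℂ) with hcdef
  have hcc : c * c = 1 / 2 := by
    rw [hcdef, ← Complex.ofReal_mul, Real.mul_self_sqrt (by norm_num)]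
    simp
  have hc : c * conj c = 1 / 2 := by rw [hcdef, Complex.conj_ofReal, ← hcdef, hcc]
  have hfield : IsSpinorField x
      (fun i k => c * α * Complex.I * ((if i < k then 1 else -1) * (phase (θ i) * phase (θ k))) +
        -(c * conj β) * 1)
      (fun i k => c * β * Complex.I * ((if i < k then 1 else -1) * (phase (θ i) * phase (θ k))) +
        c * conj α * 1) := by
    intro i k hik
    set s : ℂ := if i < k then 1 else -1 with hsdef
    have hss : s * conj s = 1 := by
      rw [hsdef]; split_ifs <;> simp
    have hsabs : s * ((|Real.sin (θ k - θ i)| : ℝ) : ℂ) = (Real.sin (θ k - θ i) : ℂ) := by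
      rcases lt_or_gt_of_ne hik with hlt | hlt
      · rw [hsdef, if_pos hlt, abs_of_pos
          (Real.sin_pos_of_pos_of_lt_pi (hθ i k hlt).1 (hθ i k hlt).2), one_mul]
      · have hpos := Real.sin_pos_of_pos_of_lt_pi (hθ k i hlt).1 (hθ k i hlt).2
        rw [← neg_sub, Real.sin_neg] at hpos
        rw [hsdef, if_neg hlt.not_gt, abs_of_neg (by linarith)]
        push_cast
        ring
    have hdiff : (R : ℂ) * phase (θ k) ^ 2 - R * phase (θ i) ^ 2 =
        R * (phase (θ i) * phase (θ k) * (2 * Complex.I * Real.sin (θ k - θ i))) := by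
      rw [← phase_sq_sub_sq]; ring
    have hnorm : ‖(R : ℂ) * phase (θ k) ^ 2 - R * phase (θ i) ^ 2‖ =
        2 * R * |Real.sin (θ k - θ i)| := by
      rw [hdiff]
      simp only [norm_mul, norm_phase, Complex.norm_I, Complex.norm_real, Real.norm_eq_abs,
        abs_of_nonneg hR, Complex.norm_ofNat]
      ring
    have key := (h i k).isSpinor (u := s * Complex.I * (phase (θ i) * phase (θ k))) (c := c) hs
      (by
        simp only [map_mul, Complex.conj_I]
        linear_combination (-(s * conj s) * (phase (θ i) * conj (phase (θ i))) *
          (phase (θ k) * conj (phase (θ k)))) * Complex.I_sq + (phase (θ i) * conj (phase (θ i))) *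
          (phase (θ k) * conj (phase (θ k))) * hss + (phase (θ k) * conj (phase (θ k))) *
          phase_mul_conj (θ i) + phase_mul_conj (θ k)) hc
      (by
        rw [hnorm, hdiff]
        simp only [Complex.ofReal_mul, Complex.ofReal_ofNat]
        linear_combination (2 * R * Complex.I * (phase (θ i) * phase (θ k)) : ℂ) * hsabs)
    convert key using 1 <;> ring
  have hdet := det_coeffMatrix_linear
    (fun i k : Fin n => (if i < k then 1 else -1) * (phase (θ i) * phase (θ k))) (fun _ _ => 1)
    (c * α * Complex.I) (-(c * conj β)) (c * β * Complex.I) (c * conj α)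
  rw [← hfield.norm_det hx, hdet, norm_mul, norm_pow]
  -- The factor `i` of the chord is absorbed into the substitution, whose determinant has modulus `1
  -- / 2`; this is the source of the power of `1 / 2`.
  have hδ : c * α * Complex.I * (c * conj α) - -(c * conj β) * (c * β * Complex.I) =
      Complex.I / 2 := by
    linear_combination Complex.I * (α * conj α + β * conj β) * hcc + Complex.I / 2 * hs
  rw [hδ, mul_comm]
  simp [circleDet]

/-! ### Explicit determinants for three and four points. -/

theorem coeffMatrix_fin_three (z : Fin 3 → Fin 3 → ℂ) :
    coeffMatrix z (fun _ _ => 1) =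
      !![1, -(z 0 1 + z 0 2), z 0 1 * z 0 2;
         1, -(z 1 0 + z 1 2), z 1 0 * z 1 2;
         1, -(z 2 0 + z 2 1), z 2 0 * z 2 1] := by
  have h : ∀ i : Fin 3, ∀ c : Fin 3 → ℂ, rowPoly z (fun _ _ => 1) i =
      ∑ j : Fin 3, MvPolynomial.C (c j) * MvPolynomial.X (0 : Fin 2) ^ (j : ℕ) *
        MvPolynomial.X 1 ^ (3 - 1 - (j : ℕ)) → ∀ j, coeffMatrix z (fun _ _ => 1) i j = c j := by
    intro i c hc j
    rw [coeffMatrix, Matrix.of_apply, hc, coeff_sum_binary]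
  have e0 : (Finset.univ.erase 0 : Finset (Fin 3)) = {1, 2} := by decide
  have e1 : (Finset.univ.erase 1 : Finset (Fin 3)) = {0, 2} := by decide
  have e2 : (Finset.univ.erase 2 : Finset (Fin 3)) = {0, 1} := by decide
  ext i j
  fin_cases i
  · refine (h 0 ![1, -(z 0 1 + z 0 2), z 0 1 * z 0 2] ?_ j).trans ?_
    · rw [rowPoly, e0, Finset.prod_pair (by decide)]
      simp [Fin.sum_univ_succ]
      ring
    · fin_cases j <;> rfl
  · refine (h 1 ![1, -(z 1 0 + z 1 2), z 1 0 * z 1 2] ?_ j).trans ?_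
    · rw [rowPoly, e1, Finset.prod_pair (by decide)]
      simp [Fin.sum_univ_succ]
      ring
    · fin_cases j <;> rfl
  · refine (h 2 ![1, -(z 2 0 + z 2 1), z 2 0 * z 2 1] ?_ j).trans ?_
    · rw [rowPoly, e2, Finset.prod_pair (by decide)]
      simp [Fin.sum_univ_succ]
      ring
    · fin_cases j <;> rfl

/-- The coefficients of `∏ (a t₁ - t₂)` over three values of `a`. -/
def cubicCoeffs (a b c : ℂ) : Fin 4 → ℂ :=
  ![-1, a + b + c, -(a * b + a * c + b * c), a * b * c]

theorem coeffMatrix_fin_four (z : Fin 4 → Fin 4 → ℂ) :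
    coeffMatrix z (fun _ _ => 1) = Matrix.of ![cubicCoeffs (z 0 1) (z 0 2) (z 0 3),
      cubicCoeffs (z 1 0) (z 1 2) (z 1 3), cubicCoeffs (z 2 0) (z 2 1) (z 2 3),
      cubicCoeffs (z 3 0) (z 3 1) (z 3 2)] := by
  have h : ∀ i a b c : Fin 4, Finset.univ.erase i = {a, b, c} → a ∉ ({b, c} : Finset (Fin 4)) →
      b ≠ c → ∀ j, coeffMatrix z (fun _ _ => 1) i j = cubicCoeffs (z i a) (z i b) (z i c) j := by
    intro i a b c he ha hb j
    rw [coeffMatrix, Matrix.of_apply, ← coeff_sum_binary (cubicCoeffs (z i a) (z i b) (z i c)) j]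
    congr 1
    rw [rowPoly, he, Finset.prod_insert ha, Finset.prod_pair hb]
    simp [Fin.sum_univ_succ, cubicCoeffs]
    ring
  ext i j
  fin_cases i
  · exact h 0 1 2 3 (by decide) (by decide) (by decide) j
  · exact h 1 0 2 3 (by decide) (by decide) (by decide) j
  · exact h 2 0 1 3 (by decide) (by decide) (by decide) j
  · exact h 3 0 1 2 (by decide) (by decide) (by decide) j

theorem phase_div_add_div (s t : ℝ) :
    phase s / phase t + phase t / phase s = ((2 * Real.cos (t - s) : ℝ) : ℂ) := by
  have h1 : phase s / phase t = Complex.exp (-((t - s : ℝ) : ℂ) * Complex.I) := by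
    rw [phase, phase, ← Complex.exp_sub]; push_cast; ring_nf
  have h2 : phase t / phase s = Complex.exp (((t - s : ℝ) : ℂ) * Complex.I) := by
    rw [phase, phase, ← Complex.exp_sub]; push_cast; ring_nf
  rw [h1, h2, Complex.ofReal_mul, Complex.ofReal_cos, Complex.cos]
  push_cast
  ring

theorem phase_add (s t : ℝ) : phase (s + t) = phase s * phase t := by
  rw [phase, phase, phase, ← Complex.exp_add]; push_cast; ring_nf

theorem phase_two_mul (t : ℝ) : phase (2 * t) = phase t ^ 2 := by
  rw [two_mul, phase_add, sq]

theorem norm_circleDet_fin_three (θ : Fin 3 → ℝ) :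
    ‖circleDet θ‖ = |6 + 2 * (Real.cos (θ 1 - θ 0) + Real.cos (θ 2 - θ 1) -
      Real.cos (θ 2 - θ 0))| := by
  have h0 := phase_ne_zero (θ 0)
  have h1 := phase_ne_zero (θ 1)
  have h2 := phase_ne_zero (θ 2)
  have e : circleDet θ = (phase (θ 0) * phase (θ 1) * phase (θ 2)) ^ 2 *
      ((6 + 2 * (Real.cos (θ 1 - θ 0) + Real.cos (θ 2 - θ 1) - Real.cos (θ 2 - θ 0)) : ℝ) : ℂ) := by
    have ec : ((6 + 2 * (Real.cos (θ 1 - θ 0) + Real.cos (θ 2 - θ 1) - Real.cos (θ 2 - θ 0)) : ℝ)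
        : ℂ) = 6 + (((2 * Real.cos (θ 1 - θ 0) : ℝ) : ℂ) + ((2 * Real.cos (θ 2 - θ 1) : ℝ) : ℂ) -
          ((2 * Real.cos (θ 2 - θ 0) : ℝ) : ℂ)) := by push_cast; ring
    rw [ec, ← phase_div_add_div, ← phase_div_add_div, ← phase_div_add_div, circleDet,
      coeffMatrix_fin_three, Matrix.det_fin_three]
    generalize phase (θ 0) = a, phase (θ 1) = b, phase (θ 2) = c at *
    simp [Fin.lt_def]
    field_simp
    ring
  rw [e]
  simp only [norm_mul, norm_pow, norm_phase, Complex.norm_real, Real.norm_eq_abs]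
  ring

/-- `64` times the Atiyah determinant of four points `exp (2 i θ k)` of the unit circle. -/
def quadCos (θ : Fin 4 → ℝ) : ℝ :=
  24 + 16 * (Real.cos (θ 1 - θ 0) + Real.cos (θ 2 - θ 1) + Real.cos (θ 3 - θ 2) -
      Real.cos (θ 3 - θ 0)) +
    4 * (Real.cos (2 * θ 1 - 2 * θ 0) + Real.cos (2 * θ 2 - 2 * θ 1) +
      Real.cos (2 * θ 3 - 2 * θ 2) + Real.cos (2 * θ 3 - 2 * θ 0)) -
    4 * (Real.cos (2 * θ 2 - 2 * θ 0) + Real.cos (2 * θ 3 - 2 * θ 1)) +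
    4 * (Real.cos (2 * θ 1 - (θ 0 + θ 2)) + Real.cos (2 * θ 2 - (θ 1 + θ 3)) -
      Real.cos (2 * θ 0 - (θ 1 + θ 3)) - Real.cos (2 * θ 3 - (θ 0 + θ 2)))

theorem quadCos_eq (θ : Fin 4 → ℝ) : (quadCos θ : ℂ) =
    24 + 8 * (phase (θ 0) / phase (θ 1) + phase (θ 1) / phase (θ 0) +
      (phase (θ 1) / phase (θ 2) + phase (θ 2) / phase (θ 1)) +
      (phase (θ 2) / phase (θ 3) + phase (θ 3) / phase (θ 2)) -
      (phase (θ 0) / phase (θ 3) + phase (θ 3) / phase (θ 0))) +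
    2 * (phase (θ 0) ^ 2 / phase (θ 1) ^ 2 + phase (θ 1) ^ 2 / phase (θ 0) ^ 2 +
      (phase (θ 1) ^ 2 / phase (θ 2) ^ 2 + phase (θ 2) ^ 2 / phase (θ 1) ^ 2) +
      (phase (θ 2) ^ 2 / phase (θ 3) ^ 2 + phase (θ 3) ^ 2 / phase (θ 2) ^ 2) +
      (phase (θ 0) ^ 2 / phase (θ 3) ^ 2 + phase (θ 3) ^ 2 / phase (θ 0) ^ 2)) -
    2 * (phase (θ 0) ^ 2 / phase (θ 2) ^ 2 + phase (θ 2) ^ 2 / phase (θ 0) ^ 2 +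
      (phase (θ 1) ^ 2 / phase (θ 3) ^ 2 + phase (θ 3) ^ 2 / phase (θ 1) ^ 2)) +
    2 * ((phase (θ 0) * phase (θ 2)) / phase (θ 1) ^ 2 +
        phase (θ 1) ^ 2 / (phase (θ 0) * phase (θ 2)) +
      ((phase (θ 1) * phase (θ 3)) / phase (θ 2) ^ 2 +
        phase (θ 2) ^ 2 / (phase (θ 1) * phase (θ 3))) -
      ((phase (θ 1) * phase (θ 3)) / phase (θ 0) ^ 2 +
        phase (θ 0) ^ 2 / (phase (θ 1) * phase (θ 3))) -
      ((phase (θ 0) * phase (θ 2)) / phase (θ 3) ^ 2 +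
        phase (θ 3) ^ 2 / (phase (θ 0) * phase (θ 2)))) := by
  simp only [← phase_two_mul, ← phase_add, phase_div_add_div]
  rw [quadCos]
  push_cast
  ring

theorem det_quad_phase {a b c d : ℂ} (ha : a ≠ 0) (hb : b ≠ 0) (hc : c ≠ 0) (hd : d ≠ 0) :
    (Matrix.of ![cubicCoeffs (a * b) (a * c) (a * d), cubicCoeffs (-(b * a)) (b * c) (b * d),
      cubicCoeffs (-(c * a)) (-(c * b)) (c * d),
      cubicCoeffs (-(d * a)) (-(d * b)) (-(d * c))]).det =
    (a * b * c * d) ^ 3 * (24 + 8 * (a / b + b / a + (b / c + c / b) + (c / d + d / c) -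
      (a / d + d / a)) +
    2 * (a ^ 2 / b ^ 2 + b ^ 2 / a ^ 2 + (b ^ 2 / c ^ 2 + c ^ 2 / b ^ 2) +
      (c ^ 2 / d ^ 2 + d ^ 2 / c ^ 2) + (a ^ 2 / d ^ 2 + d ^ 2 / a ^ 2)) -
    2 * (a ^ 2 / c ^ 2 + c ^ 2 / a ^ 2 + (b ^ 2 / d ^ 2 + d ^ 2 / b ^ 2)) +
    2 * ((a * c) / b ^ 2 + b ^ 2 / (a * c) + ((b * d) / c ^ 2 + c ^ 2 / (b * d)) -
      ((b * d) / a ^ 2 + a ^ 2 / (b * d)) - ((a * c) / d ^ 2 + d ^ 2 / (a * c)))) := by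
  rw [Matrix.det_succ_row_zero]
  simp [Fin.sum_univ_succ, Matrix.det_fin_three, cubicCoeffs, Fin.succAbove]
  field_simp
  ring

theorem norm_circleDet_fin_four (θ : Fin 4 → ℝ) : ‖circleDet θ‖ = |quadCos θ| := by
  have e : circleDet θ = (phase (θ 0) * phase (θ 1) * phase (θ 2) * phase (θ 3)) ^ 3 *
      (quadCos θ : ℂ) := by
    rw [quadCos_eq, ← det_quad_phase (phase_ne_zero _) (phase_ne_zero _) (phase_ne_zero _)
      (phase_ne_zero _), circleDet, coeffMatrix_fin_four]
    simp [Fin.lt_def]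
  rw [e]
  simp only [norm_mul, norm_pow, norm_phase, Complex.norm_real, Real.norm_eq_abs]
  ring

/-! ### Trigonometry of triangles and cyclic quadrilaterals. -/

-- For a triangle with half angles `A`, `B`, `π / 2 - A - B` this is the classical formula: the sum
-- of the cosines of the angles is one plus four times the product of the sines of the half angles.
open Real in
theorem cos_add_cos_sub_cos_add (A B : ℝ) :
    cos (2 * A) + cos (2 * B) - cos (2 * A + 2 * B) = 1 + 4 * (sin A * sin B * cos (A + B)) := by
  have h1 : cos (2 * A) + cos (2 * B) = 2 * cos (A + B) * cos (A - B) := by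
    rw [cos_add_cos]; ring_nf
  have h2 : cos (2 * A + 2 * B) = 2 * cos (A + B) ^ 2 - 1 := by
    rw [← cos_two_mul]; ring_nf
  have h3 : cos (A - B) - cos (A + B) = 2 * (sin A * sin B) := by
    rw [cos_sub, cos_add]; ring
  linear_combination h1 - h2 + 2 * cos (A + B) * h3

open Real in
/-- The sum of the four modified double-angle cosines of a cyclic quadrilateral. -/
theorem cos_two_mul_quad {a b c d : ℝ} (h : a + b + c + d = π) :
    cos (2 * a) + cos (2 * b) + cos (2 * c) + cos (2 * d) - cos (2 * (a + b)) - cos (2 * (b + c)) +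
      cos (a - b) + cos (b - c) + cos (c - d) + cos (d - a) =
    2 + 2 * (sin a * sin b * (1 + cos (a + b)) + sin b * sin c * (1 + cos (b + c)) +
      sin c * sin d * (1 + cos (c + d)) + sin d * sin a * (1 + cos (d + a))) := by
  have hs : ∀ u v : ℝ, cos (2 * u) + cos (2 * v) = 2 * cos (u + v) * cos (u - v) := by
    intro u v
    rw [cos_add_cos]; ring_nf
  have hd : ∀ u v : ℝ, cos (u - v) = cos (u + v) + 2 * (sin u * sin v) := by
    intro u v
    rw [cos_sub, cos_add]; ring
  have e1 : cos (c + d) = -cos (a + b) := by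
    rw [← cos_pi_sub]; congr 1; linarith
  have e2 : cos (d + a) = -cos (b + c) := by
    rw [← cos_pi_sub]; congr 1; linarith
  have h1 := hs a b
  have h2 := hs b c
  have h3 := hs c d
  have h4 := hs d a
  rw [hd] at h1 h2 h3 h4
  rw [e1] at h3
  rw [e2] at h4
  rw [hd a b, hd b c, hd c d, hd d a, e1, e2, cos_two_mul (a + b), cos_two_mul (b + c)]
  linear_combination (h1 + h2 + h3 + h4) / 2

open Real in
theorem quadCos_eq_half_angles {θ : Fin 4 → ℝ} {A B C D : ℝ} (hA : θ 1 - θ 0 = 2 * A)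
    (hB : θ 2 - θ 1 = 2 * B) (hC : θ 3 - θ 2 = 2 * C) (h : A + B + C + D = π / 2) :
    quadCos θ = 64 * (1 + (sin A * sin B * cos (A + B) + sin C * sin D * cos (C + D)) +
      (sin A * sin B * (cos A * cos B) * cos (A + B) ^ 2 +
        sin B * sin C * (cos B * cos C) * cos (B + C) ^ 2 +
        sin C * sin D * (cos C * cos D) * cos (C + D) ^ 2 +
        sin D * sin A * (cos D * cos A) * cos (D + A) ^ 2)) := by
  have hq := cos_two_mul_quad (a := 2 * A) (b := 2 * B) (c := 2 * C) (d := 2 * D) (by linarith)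
  have hAB := cos_add_cos_sub_cos_add A B
  have hCD := cos_add_cos_sub_cos_add C D
  -- The diagonal seen from both sides gives supplementary angles, so its cosines cancel in `hAB +
  -- hCD` and only the four side cosines remain.
  have e1 : cos (2 * C + 2 * D) = -cos (2 * A + 2 * B) := by
    rw [← cos_pi_sub]; congr 1; linarith
  have hsq : ∀ u v : ℝ, sin (2 * u) * sin (2 * v) * (1 + cos (2 * u + 2 * v)) =
      8 * (sin u * sin v * (cos u * cos v) * cos (u + v) ^ 2) := by
    intro u v
    rw [← mul_add, cos_two_mul, sin_two_mul, sin_two_mul]; ring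
  rw [hsq, hsq, hsq, hsq] at hq
  rw [e1] at hCD
  have hpi : ∀ u v : ℝ, u + v = π → cos u = -cos v := by
    intro u v huv
    rw [← cos_pi_sub]; congr 1; linarith
  -- The closing side satisfies `θ 3 - θ 0 = π - 2 * D`. The resulting sign changes absorb the
  -- asymmetric signs of `quadCos` and restore the cyclic symmetry in `A, B, C, D`.
  have f0 : cos (θ 3 - θ 0) = -cos (2 * D) := hpi _ _ (by linarith)
  have f1 : cos (2 * θ 3 - 2 * θ 0) = cos (2 * (2 * D)) := by
    rw [show 2 * θ 3 - 2 * θ 0 = 2 * π - 2 * (2 * D) by linarith, cos_two_pi_sub]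
  have f2 : cos (2 * θ 0 - (θ 1 + θ 3)) = -cos (2 * D - 2 * A) := by
    rw [← cos_neg]; exact hpi _ _ (by linarith)
  have f3 : cos (2 * θ 3 - (θ 0 + θ 2)) = -cos (2 * C - 2 * D) := by
    rw [← cos_neg (2 * C - 2 * D)]; exact hpi _ _ (by linarith)
  rw [quadCos, f0, f1, f2, f3, hA, hB, hC,
    show 2 * θ 1 - 2 * θ 0 = 2 * (2 * A) by linarith,
    show 2 * θ 2 - 2 * θ 1 = 2 * (2 * B) by linarith,
    show 2 * θ 3 - 2 * θ 2 = 2 * (2 * C) by linarith,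
    show 2 * θ 2 - 2 * θ 0 = 2 * (2 * A + 2 * B) by linarith,
    show 2 * θ 3 - 2 * θ 1 = 2 * (2 * B + 2 * C) by linarith,
    show 2 * θ 1 - (θ 0 + θ 2) = 2 * A - 2 * B by linarith,
    show 2 * θ 2 - (θ 1 + θ 3) = 2 * B - 2 * C by linarith]
  linear_combination 4 * hq + 16 * hAB + 16 * hCD

open Real in
/-- Both pairs of opposite triangles of a cyclic quadrilateral have the same sum of
`sin * sin * sin` of their half angles. -/
theorem opposite_triangles_sum {A B C D : ℝ} (h : A + B + C + D = π / 2) :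
    sin A * sin B * cos (A + B) + sin C * sin D * cos (C + D) =
      sin B * sin C * cos (B + C) + sin D * sin A * cos (D + A) := by
  have hAB := cos_add_cos_sub_cos_add A B
  have hCD := cos_add_cos_sub_cos_add C D
  have hBC := cos_add_cos_sub_cos_add B C
  have hDA := cos_add_cos_sub_cos_add D A
  have e1 : cos (2 * C + 2 * D) = -cos (2 * A + 2 * B) := by
    rw [← cos_pi_sub]; congr 1; linarith
  have e2 : cos (2 * D + 2 * A) = -cos (2 * B + 2 * C) := by
    rw [← cos_pi_sub]; congr 1; linarith
  rw [e1] at hCD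
  rw [e2] at hDA
  -- With the diagonal cosines cancelled, each side is a quarter of the sum of the four side cosines
  -- minus `2`.
  linear_combination (hBC + hDA - hAB - hCD) / 4

-- The point is that `cos (A + B) ≥ 0` says exactly `sin A * sin B ≤ cos A * cos B`. It bounds the
-- second-order terms of the quadrilateral below by squares of the triangle terms.
open Real in
theorem sq_le_sin_mul_cos {A B : ℝ} (hA : 0 ≤ A) (hB : 0 ≤ B) (h : A + B ≤ π / 2) :
    0 ≤ sin A * sin B * cos (A + B) ∧ (sin A * sin B * cos (A + B)) ^ 2 ≤
      sin A * sin B * (cos A * cos B) * cos (A + B) ^ 2 := by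
  have hsA : 0 ≤ sin A := sin_nonneg_of_nonneg_of_le_pi hA (by linarith [pi_pos])
  have hsB : 0 ≤ sin B := sin_nonneg_of_nonneg_of_le_pi hB (by linarith [pi_pos])
  have hc : 0 ≤ cos (A + B) := cos_nonneg_of_neg_pi_div_two_le_of_le (by linarith [pi_pos]) h
  have hle : sin A * sin B ≤ cos A * cos B := by
    rw [cos_add] at hc; linarith
  refine ⟨by positivity, ?_⟩
  calc (sin A * sin B * cos (A + B)) ^ 2
      = sin A * sin B * (sin A * sin B) * cos (A + B) ^ 2 := by ring
    _ ≤ _ := by gcongr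

/-- AM-GM within each pair of equal sum `m`, followed by `(1 + m/2)^2 = 1 + m + m^2/4`. -/
theorem prod_one_add_le {p q r s y m : ℝ} (hr : 0 ≤ r) (hs : 0 ≤ s)
    (hpq : p + q = m) (hrs : r + s = m) (hy : m ^ 2 / 4 ≤ y) :
    (1 + r) * (1 + q) * (1 + s) * (1 + p) ≤ (1 + m + y) ^ 2 := by
  have h1 : (1 + p) * (1 + q) ≤ (1 + m / 2) ^ 2 := by subst hpq; nlinarith [sq_nonneg (p - q)]
  have h2 : (1 + r) * (1 + s) ≤ (1 + m / 2) ^ 2 := by subst hrs; nlinarith [sq_nonneg (r - s)]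
  have h3 : (1 + m / 2) ^ 2 ≤ 1 + m + y := by
    linarith [show (1 + m / 2) ^ 2 = 1 + m + m ^ 2 / 4 by ring]
  calc (1 + r) * (1 + q) * (1 + s) * (1 + p) = ((1 + p) * (1 + q)) * ((1 + r) * (1 + s)) := by ring
    _ ≤ (1 + m + y) * (1 + m + y) := by
      gcongr
      · exact (sq_nonneg _).trans h3
      · exact h1.trans h3
      · exact h2.trans h3
    _ = _ := by ring

open Real in
theorem quad_inequality {A B C D : ℝ} (hA : 0 ≤ A) (hB : 0 ≤ B) (hC : 0 ≤ C) (hD : 0 ≤ D)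
    (h : A + B + C + D = π / 2) :
    (1 + sin B * sin C * cos (B + C)) * (1 + sin C * sin D * cos (C + D)) *
      (1 + sin D * sin A * cos (D + A)) * (1 + sin A * sin B * cos (A + B)) ≤
    (1 + (sin A * sin B * cos (A + B) + sin C * sin D * cos (C + D)) +
      (sin A * sin B * (cos A * cos B) * cos (A + B) ^ 2 +
        sin B * sin C * (cos B * cos C) * cos (B + C) ^ 2 +
        sin C * sin D * (cos C * cos D) * cos (C + D) ^ 2 +
        sin D * sin A * (cos D * cos A) * cos (D + A) ^ 2)) ^ 2 := by
  obtain ⟨p0, p1⟩ := sq_le_sin_mul_cos hA hB (by linarith)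
  obtain ⟨r0, r1⟩ := sq_le_sin_mul_cos hB hC (by linarith)
  obtain ⟨q0, q1⟩ := sq_le_sin_mul_cos hC hD (by linarith)
  obtain ⟨s0, s1⟩ := sq_le_sin_mul_cos hD hA (by linarith)
  refine prod_one_add_le r0 s0 rfl (opposite_triangles_sum h).symm ?_
  -- The squares from one opposite pair already suffice; the other two second-order terms are only
  -- needed to be nonnegative.
  have hm : (sin A * sin B * cos (A + B) + sin C * sin D * cos (C + D)) ^ 2 / 4 ≤
      (sin A * sin B * cos (A + B)) ^ 2 + (sin C * sin D * cos (C + D)) ^ 2 := by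
    nlinarith [sq_nonneg (sin A * sin B * cos (A + B) - sin C * sin D * cos (C + D)),
      sq_nonneg (sin A * sin B * cos (A + B)), sq_nonneg (sin C * sin D * cos (C + D))]
  linarith [(sq_nonneg _).trans r1, (sq_nonneg _).trans s1]

/-! ### The determinant inequality. -/

theorem circleDet_fin_four_inequality {θ : Fin 4 → ℝ} (h01 : θ 0 < θ 1) (h12 : θ 1 < θ 2)
    (h23 : θ 2 < θ 3) (h30 : θ 3 - θ 0 < Real.pi) :
    ∏ i : Fin 4, ((1 / 8) * ‖circleDet (θ ∘ i.succAbove)‖) ≤ ((1 / 64) * ‖circleDet θ‖) ^ 2 := by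
  obtain ⟨A, hA⟩ : ∃ A, A = (θ 1 - θ 0) / 2 := ⟨_, rfl⟩
  obtain ⟨B, hB⟩ : ∃ B, B = (θ 2 - θ 1) / 2 := ⟨_, rfl⟩
  obtain ⟨C, hC⟩ : ∃ C, C = (θ 3 - θ 2) / 2 := ⟨_, rfl⟩
  -- `D` belongs to the closing arc from the last point back to the first; it is positive because `θ
  -- 3 - θ 0 < π`.
  obtain ⟨D, hD⟩ : ∃ D, D = Real.pi / 2 - A - B - C := ⟨_, rfl⟩
  have h : A + B + C + D = Real.pi / 2 := by linarith
  have tri : ∀ (X Y : ℝ) (φ : Fin 3 → ℝ), 0 ≤ X → 0 ≤ Y → X + Y ≤ Real.pi / 2 →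
      Real.cos (φ 1 - φ 0) + Real.cos (φ 2 - φ 1) - Real.cos (φ 2 - φ 0) =
        Real.cos (2 * X) + Real.cos (2 * Y) - Real.cos (2 * X + 2 * Y) →
      (1 / 8) * ‖circleDet φ‖ = 1 + Real.sin X * Real.sin Y * Real.cos (X + Y) := by
    intro X Y φ hX hY hXY he
    have h0 := (sq_le_sin_mul_cos hX hY hXY).1
    rw [norm_circleDet_fin_three, he, cos_add_cos_sub_cos_add, abs_of_nonneg (by linarith)]
    ring
  have hpi : ∀ u v : ℝ, u + v = Real.pi → Real.cos u = -Real.cos v := by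
    intro u v huv
    rw [← Real.cos_pi_sub]; congr 1; linarith
  have t3 := tri A B (θ ∘ (3 : Fin 4).succAbove) (by linarith) (by linarith) (by linarith) (by
    change Real.cos (θ 1 - θ 0) + Real.cos (θ 2 - θ 1) - Real.cos (θ 2 - θ 0) = _
    rw [show θ 1 - θ 0 = 2 * A by linarith, show θ 2 - θ 1 = 2 * B by linarith,
      show θ 2 - θ 0 = 2 * A + 2 * B by linarith])
  have t0 := tri B C (θ ∘ (0 : Fin 4).succAbove) (by linarith) (by linarith) (by linarith) (by
    change Real.cos (θ 2 - θ 1) + Real.cos (θ 3 - θ 2) - Real.cos (θ 3 - θ 1) = _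
    rw [show θ 2 - θ 1 = 2 * B by linarith, show θ 3 - θ 2 = 2 * C by linarith,
      show θ 3 - θ 1 = 2 * B + 2 * C by linarith])
  -- This triangle contains the closing side: supplementary angles replace the gaps `θ 2 - θ 0` and
  -- `θ 3 - θ 0` by `2 * C + 2 * D` and `2 * D`, exchanging two cosines of opposite sign.
  have t1 := tri C D (θ ∘ (1 : Fin 4).succAbove) (by linarith) (by linarith) (by linarith) (by
    change Real.cos (θ 2 - θ 0) + Real.cos (θ 3 - θ 2) - Real.cos (θ 3 - θ 0) = _
    rw [hpi (θ 2 - θ 0) (2 * C + 2 * D) (by linarith), hpi (θ 3 - θ 0) (2 * D) (by linarith),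
      show θ 3 - θ 2 = 2 * C by linarith]
    ring)
  have t2 := tri D A (θ ∘ (2 : Fin 4).succAbove) (by linarith) (by linarith) (by linarith) (by
    change Real.cos (θ 1 - θ 0) + Real.cos (θ 3 - θ 1) - Real.cos (θ 3 - θ 0) = _
    rw [hpi (θ 3 - θ 1) (2 * D + 2 * A) (by linarith), hpi (θ 3 - θ 0) (2 * D) (by linarith),
      show θ 1 - θ 0 = 2 * A by linarith]
    ring)
  rw [Fin.prod_univ_four, t0, t1, t2, t3, norm_circleDet_fin_four,
    quadCos_eq_half_angles (A := A) (B := B) (C := C) (by linarith) (by linarith) (by linarith) h,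
    mul_pow, sq_abs, ← mul_pow, ← mul_assoc]
  norm_num only [one_mul]
  exact quad_inequality (by linarith) (by linarith) (by linarith) (by linarith) h

/-- The determinant inequality for four points in order along a circle. -/
theorem prod_norm_atiyahDet_le_of_ordered {x : Fin 4 → Space} (hx : Function.Injective x)
    {α β : ℂ} (hs : α * conj α + β * conj β = 1) {R : ℝ} (hR : 0 ≤ R) {θ : Fin 4 → ℝ}
    (hθ : StrictMono θ) (hθ' : θ 3 - θ 0 < Real.pi)
    (h : ∀ i k, IsPlaneVector α β (R * phase (θ k) ^ 2 - R * phase (θ i) ^ 2) (x k - x i)) :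
    ∏ i : Fin 4, ‖atiyahDet (x ∘ i.succAbove)‖ ≤ ‖atiyahDet x‖ ^ 2 := by
  have hgap : ∀ i k : Fin 4, i < k → 0 < θ k - θ i ∧ θ k - θ i < Real.pi := fun i k hik =>
    ⟨sub_pos.2 (hθ hik), lt_of_le_of_lt (sub_le_sub (hθ.monotone (Fin.le_last k))
      (hθ.monotone (Fin.zero_le i))) hθ'⟩
  have h4 := norm_atiyahDet_eq_circleDet hx hs hR hgap h
  have h3 : ∀ i : Fin 4, ‖atiyahDet (x ∘ i.succAbove)‖ =
      (1 / 8) * ‖circleDet (θ ∘ i.succAbove)‖ := by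
    intro i
    rw [norm_atiyahDet_eq_circleDet (hx.comp (Fin.succAbove_right_injective (p := i))) hs hR
      (θ := θ ∘ i.succAbove) (fun j k hjk => hgap _ _ (Fin.strictMono_succAbove i hjk))
      fun j k => h _ _, show (∑ i : Fin 3, (Finset.Ioi i).card) = 3 by decide]
    norm_num
  rw [show (∑ i : Fin 4, (Finset.Ioi i).card) = 6 by decide] at h4
  have e : (1 / 2 : ℝ) ^ 6 = 1 / 64 := by norm_num
  rw [h4, e, Finset.prod_congr rfl fun i _ => h3 i]
  exact circleDet_fin_four_inequality (hθ (by decide)) (hθ (by decide)) (hθ (by decide)) hθ'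

end AtiyahSutcliffe

end

theorem theorem3p3 (x : Fin 4 → EuclideanSpace ℝ (Fin 3)) (hx : Function.Injective x)
    (hcirc : EuclideanGeometry.Concyclic (Set.range x)) :
    ∏ i : Fin 4, ‖AtiyahSutcliffe.atiyahDet (x ∘ i.succAbove)‖ ≤
      ‖AtiyahSutcliffe.atiyahDet x‖ ^ 2 := by
  obtain ⟨α, β, R, ζ, hs, hζ, hp⟩ := AtiyahSutcliffe.exists_planeCoord_of_concyclic hcirc
  have hR : 0 ≤ R := hζ 0 ▸ norm_nonneg _
  -- Halved arguments lie in `(-π/2, π/2]`, half-open, so any two differ by less than `π`; sorting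
  -- them puts the points in order along the circle.
  set θ : Fin 4 → ℝ := fun i => (ζ i).arg / 2
  have hζθ : ∀ i, ζ i = R * AtiyahSutcliffe.phase (θ i) ^ 2 := by
    intro i
    rw [← AtiyahSutcliffe.phase_two_mul, mul_div_cancel₀ _ (two_ne_zero' ℝ), ← hζ i]
    exact (Complex.norm_mul_exp_arg_mul_I (ζ i)).symm
  have hinj : Function.Injective θ := by
    intro i k hik
    have h0 : ζ k - ζ i = 0 := by rw [hζθ k, hζθ i, hik, sub_self]
    have hn := (hp i k).norm_eq hs
    rw [h0, norm_zero, norm_eq_zero, sub_eq_zero] at hn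
    exact (hx hn).symm
  have hmono : StrictMono (θ ∘ Tuple.sort θ) :=
    (Tuple.monotone_sort θ).strictMono_of_injective (hinj.comp (Tuple.sort θ).injective)
  have hrange : (θ ∘ Tuple.sort θ) 3 - (θ ∘ Tuple.sort θ) 0 < Real.pi := by
    have h1 := Complex.arg_le_pi (ζ (Tuple.sort θ 3))
    have h2 := Complex.neg_pi_lt_arg (ζ (Tuple.sort θ 0))
    simp only [Function.comp_apply, θ] at *
    linarith
  rw [← AtiyahSutcliffe.prod_norm_atiyahDet_comp_perm hx (Tuple.sort θ),
    ← AtiyahSutcliffe.norm_atiyahDet_comp_perm hx (Tuple.sort θ)]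
  refine AtiyahSutcliffe.prod_norm_atiyahDet_le_of_ordered (hx.comp (Tuple.sort θ).injective) hs hR
    hmono hrange fun i k => ?_
  have h := hp (Tuple.sort θ i) (Tuple.sort θ k)
  rw [hζθ (Tuple.sort θ i), hζθ (Tuple.sort θ k)] at h
  exact h
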